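/- Let $(M^n,g)$ be a Riemannian spin manifold and $k$ a symmetric $2$-tensor on $M$. Let $\mathcal S$ be the complex spinor bundle of $M$ with its Hermitian product and the connection $\nabla$ induced by the Levi-Civita connection, where vectors act by skew-Hermitian maps with $e_ie_j+e_je_i=-2\delta_{ij}$ for every local orthonormal frame $e_1,\dots,e_n$. Let $\overline{\mathcal S}=\mathcal S\oplus\mathcal S$ carry the direct sum Hermitian product (complex linear in the first slot), the direct sum connection, again denoted $\nabla$, and the Clifford action $$e_l(\psi_1,\psi_2)=(e_l\psi_1,-e_l\psi_2),\qquad e_0(\psi_1,\psi_2)=(\psi_2,\psi_1).$$ For a section $\psi$ of $\overline{\mathcal S}$ set $$N=|\psi|^2,\qquad X=\sum_i\langle e_ie_0\psi,\psi\rangle e_i,\qquad Y=\sum_i\langle \mathbf i e_i\psi,\psi\rangle e_i,\qquad \omega_{ij}=\operatorname{Im}\langle e_ie_je_0\psi,\psi\rangle ,$$ where $X$ and $Y$ are (real) vector fields and the two-form $\omega$ acts on $\overline{\mathcal S}$ by $\sum_{i,j=1}^n\omega_{ij}e_ie_j$. Let $1\le r\le\infty$ and suppose that a section $\psi$ of $\overline{\mathcal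 S}$ of class $C^r$ solves, for every local orthonormal frame and every $i$, $$\nabla_i\psi=-\tfrac12\sum_jk_{ij}e_je_0\psi-\tfrac12\mathbf i e_i\psi .$$ Then $$\varphi=e_0\bigl(N-\mathbf iY+e_0X-\tfrac12\mathbf i e_0\omega\bigr)\psi$$ is a section of $\overline{\mathcal S}$ of class $C^r$ and solves the same equation, $$\nabla_i\varphi=-\tfrac12\sum_jk_{ij}e_je_0\varphi-\tfrac12\mathbf i e_i\varphi .$$ -/

import Mathlib

open Bundle Set Manifold
open scoped ContDiff InnerProductSpace

noncomputable section

/-! ### Clifford algebra and spinor modules -/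

/-- Euclidean space `ℝⁿ`. -/
abbrev EucSp (n : ℕ) : Type := EuclideanSpace ℝ (Fin n)

/-- The quadratic form `v ↦ -|v|²` on `ℝⁿ`; in its Clifford algebra `e_i e_i = -1`. -/
def negForm (n : ℕ) : QuadraticForm ℝ (EucSp n) :=
  -LinearMap.BilinMap.toQuadraticMap (innerₗ (EucSp n))

/-- The real Clifford algebra `Cl(n)` with `v * v = -|v|²`. Mathlib's `spinGroup (negForm n)`
inside it is the group `Spin(n)`. -/
abbrev Cl (n : ℕ) : Type := CliffordAlgebra (negForm n)

/-- Clifford vectors in `Cl(n)`. -/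
abbrev clι (n : ℕ) : EucSp n →ₗ[ℝ] Cl n := CliffordAlgebra.ι (negForm n)

lemma clι_mul_self (n : ℕ) (v : EucSp n) :
    clι n v * clι n v = algebraMap ℝ (Cl n) (-(‖v‖ ^ 2)) := by
  rw [CliffordAlgebra.ι_sq_scalar]
  congr 1
  simp [negForm]

/-- A (complex) spinor module: an irreducible complex representation of `Cl(n)` on a
Hermitian vector space `S` for which vectors act by skew-Hermitian maps. -/
structure SpinorModule (n : ℕ) (S : Type*) [NormedAddCommGroup S] [InnerProductSpace ℂ S] where
  /-- The representation of the Clifford algebra. -/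
  rep : Cl n →ₐ[ℝ] Module.End ℂ S
  skew : ∀ (v : EucSp n) (a b : S), ⟪rep (clι n v) a, b⟫_ℂ = -⟪a, rep (clι n v) b⟫_ℂ
  nontrivial : Nontrivial S
  irreducible : ∀ W : Submodule ℂ S, (∀ v : EucSp n, ∀ a ∈ W, rep (clι n v) a ∈ W) →
    W = ⊥ ∨ W = ⊤

/-- The model fibre `S ⊕ S` of the spacetime spinor bundle, with its Hermitian direct sum
structure. -/
abbrev Dbl (S : Type*) : Type _ := WithLp 2 (S × S)

section Algebra

variable {n : ℕ} {S : Type*} [NormedAddCommGroup S] [InnerProductSpace ℂ S]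

/-- The endomorphism `(a, b) ↦ (f a, h b)` of `S ⊕ S`. -/
def dblMap (f h : Module.End ℂ S) : Module.End ℂ (Dbl S) where
  toFun p := WithLp.toLp 2 (f p.fst, h p.snd)
  map_add' p q := by simp [← WithLp.toLp_add]
  map_smul' c p := by simp [← WithLp.toLp_smul]

lemma dblMap_mul (f f' h h' : Module.End ℂ S) :
    dblMap f h * dblMap f' h' = dblMap (f * f') (h * h') := rfl

lemma dblMap_one : dblMap (1 : Module.End ℂ S) 1 = 1 := rfl

/-- `e₀ (a, b) = (b, a)`. -/
def e0 : Module.End ℂ (Dbl S) where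
  toFun p := WithLp.toLp 2 (p.snd, p.fst)
  map_add' p q := by simp [← WithLp.toLp_add]
  map_smul' c p := by simp [← WithLp.toLp_smul]

namespace SpinorModule

variable (σ : SpinorModule n S)

/-- Clifford multiplication on `S ⊕ S` by the vector with coordinates `v`:
`v (a, b) = (v a, - v b)`. -/
def cl (v : EucSp n) : Module.End ℂ (Dbl S) :=
  dblMap (σ.rep (clι n v)) (-σ.rep (clι n v))

/-- Clifford multiplication by the `i`-th standard basis vector. -/
def e (i : Fin n) : Module.End ℂ (Dbl S) := σ.cl (EuclideanSpace.single i 1)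

/-- The Hermitian product `⟨a, b⟩`, complex linear in the first slot (Mathlib's `⟪b, a⟫_ℂ` is
conjugate linear in `b`). -/
def herm (a b : Dbl S) : ℂ := ⟪b, a⟫_ℂ

/-- `N(ψ) = |ψ|²`. -/
def N (p : Dbl S) : ℝ := ‖p‖ ^ 2

/-- `X(ψ) = ∑ ⟨e_i e₀ ψ, ψ⟩ e_i` in coordinates; the products `⟨e_i e₀ ψ, ψ⟩` are real. -/
def X (p : Dbl S) : EucSp n :=
  WithLp.toLp 2 fun i => (herm (σ.e i (e0 p)) p).re

/-- `Y(ψ) = ∑ ⟨𝐢 e_i ψ, ψ⟩ e_i` in coordinates; the products `⟨𝐢 e_i ψ, ψ⟩` are real. -/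
def Y (p : Dbl S) : EucSp n :=
  WithLp.toLp 2 fun i => (herm (Complex.I • σ.e i p) p).re

/-- `ω_ij(ψ) = Im ⟨e_i e_j e₀ ψ, ψ⟩`. -/
def om (p : Dbl S) (i j : Fin n) : ℝ := (herm (σ.e i (σ.e j (e0 p))) p).im

/-- Clifford action `∑_{i,j} ω_ij e_i e_j` of the two-form `ω(ψ)`. -/
def clom (p : Dbl S) : Module.End ℂ (Dbl S) := ∑ i, ∑ j, (σ.om p i j : ℂ) • (σ.e i * σ.e j)

/-- `e₀ (N(ψ) - 𝐢 Y(ψ) + e₀ X(ψ) - ½ 𝐢 e₀ ω(ψ)) ψ`. -/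
def hidden (p : Dbl S) : Dbl S :=
  (e0 * ((N p : ℂ) • 1 - Complex.I • σ.cl (σ.Y p) + e0 * σ.cl (σ.X p)
    - (Complex.I / 2) • (e0 * σ.clom p)) : Module.End ℂ (Dbl S)) p

end SpinorModule

end Algebra

/-! ### Riemannian spin manifolds -/

section Geometry

variable {n : ℕ} {M : Type*} [TopologicalSpace M] [ChartedSpace (EucSp n) M]
  [IsManifold (𝓡 n) ∞ M]

variable (n M) in
/-- Smooth Riemannian metrics on the `n`-manifold `M`. -/
abbrev RMetric : Type _ :=
  ContMDiffRiemannianMetric (𝓡 n) ∞ (EucSp n) (fun x : M => TangentSpace (𝓡 n) x)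

/-- A spin structure on the Riemannian manifold `(M, g)`, in terms of local trivializations: an
open cover with smooth orthonormal frames on its members, together with a smooth
`Spin(n)`-valued cocycle that lifts the transition functions of the frames. -/
structure SpinStructure (g : RMetric n M) (ι : Type*) where
  /-- The members of the open cover. -/
  baseSet : ι → Set M
  isOpen_baseSet : ∀ a, IsOpen (baseSet a)
  /-- A choice of a member of the cover around each point. -/
  indexAt : M → ι
  mem_baseSet_at : ∀ x, x ∈ baseSet (indexAt x)
  /-- The local frames. -/
  frame : ι → Fin n → ∀ x : M, TangentSpace (𝓡 n) x
  contMDiffOn_frame : ∀ a i, ContMDiffOn (𝓡 n) (𝓡 n).tangent ∞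
    (fun x => (⟨x, frame a i x⟩ : TangentBundle (𝓡 n) M)) (baseSet a)
  orthonormal : ∀ a, ∀ x ∈ baseSet a, ∀ i j,
    g.inner x (frame a i x) (frame a j x) = if i = j then 1 else 0
  /-- The cocycle: `lift a b` passes from the trivialization `b` to the trivialization `a`. -/
  lift : ι → ι → M → Cl n
  lift_mem : ∀ a b, ∀ x ∈ baseSet a ∩ baseSet b, lift a b x ∈ spinGroup (negForm n)
  /-- Smoothness of `lift a b` as a map into the finite-dimensional space `Cl(n)`. -/
  contMDiffOn_lift : ∀ a b, ∀ f : Cl n →ₗ[ℝ] ℝ,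
    ContMDiffOn (𝓡 n) 𝓘(ℝ, ℝ) ∞ (fun x => f (lift a b x)) (baseSet a ∩ baseSet b)
  lift_self : ∀ a, ∀ x ∈ baseSet a, lift a a x = 1
  lift_comp : ∀ a b c, ∀ x ∈ baseSet a ∩ baseSet b ∩ baseSet c,
    lift a b x * lift b c x = lift a c x
  /-- If a tangent vector has coordinates `v` in the frame `a` and `w` in the frame `b`, then
  `v = lift a b · w · (lift a b)⁻¹` in `Cl(n)`. -/
  lift_covers : ∀ a b, ∀ x ∈ baseSet a ∩ baseSet b, ∀ v w : EucSp n,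
    ∑ i, v i • frame a i x = ∑ i, w i • frame b i x →
      clι n v * lift a b x = lift a b x * clι n w

variable {g : RMetric n M} {ι : Type*}
  {S : Type*} [NormedAddCommGroup S] [InnerProductSpace ℂ S] [FiniteDimensional ℂ S]

/-- The diagonal action `f ↦ (f, f)` as an `ℝ`-linear map into the bounded operators. -/
def dblDiag : Module.End ℂ S →ₗ[ℝ] (Dbl S →L[ℂ] Dbl S) where
  toFun f := LinearMap.toContinuousLinearMap (dblMap f f)
  map_add' _ _ := rfl
  map_smul' _ _ := rfl

lemma continuousOn_of_functionals {F : Type*} [NormedAddCommGroup F] [NormedSpace ℝ F]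
    [FiniteDimensional ℝ F] {B : Type*} [TopologicalSpace B] {s : Set B} {u : B → F}
    (h : ∀ f : F →ₗ[ℝ] ℝ, ContinuousOn (fun x => f (u x)) s) : ContinuousOn u s := by
  let b := Module.finBasis ℝ F
  have : u = fun x => b.equivFunL.symm (fun i => b.coord i (u x)) := by
    funext x
    exact (b.equivFunL.symm_apply_apply (u x)).symm
  rw [this]
  exact b.equivFunL.symm.continuous.comp_continuousOn
    (continuousOn_pi.2 fun i => h (b.coord i))

/-- The spacetime spinor bundle `𝒮 ⊕ 𝒮`, where `𝒮` is the vector bundle with fibre `S`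
associated to the spin structure: the transition functions are `(p, q) ↦ (s p, s q)` with `s` the
action of the `Spin(n)`-valued cocycle. -/
def SpinStructure.spinorBundle (P : SpinStructure g ι) (σ : SpinorModule n S) :
    VectorBundleCore ℂ M (Dbl S) ι where
  baseSet := P.baseSet
  isOpen_baseSet := P.isOpen_baseSet
  indexAt := P.indexAt
  mem_baseSet_at := P.mem_baseSet_at
  coordChange a b x := dblDiag (σ.rep (P.lift b a x))
  coordChange_self a x hx v := by
    rw [P.lift_self a x hx, map_one]
    rfl
  continuousOn_coordChange a b := by
    have : FiniteDimensional ℝ (Dbl S →L[ℂ] Dbl S) := FiniteDimensional.complexToReal _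
    refine continuousOn_of_functionals fun f => ?_
    have h := (P.contMDiffOn_lift b a (f ∘ₗ dblDiag ∘ₗ σ.rep.toLinearMap)).continuousOn
    rw [inter_comm] at h
    exact h
  coordChange_comp a b c x hx v := by
    rw [← P.lift_comp c b a x ⟨⟨hx.2, hx.1.2⟩, hx.1.1⟩, map_mul]
    rfl

namespace SpinStructure

variable (P : SpinStructure g ι) (σ : SpinorModule n S)

/-- Spacetime spinors: sections of the spacetime spinor bundle. The fibre over `x` is, as a type,
`S ⊕ S`, identified by the trivialization with index `P.indexAt x`. -/
abbrev Spinor : Type _ := ∀ x : M, (P.spinorBundle σ).Fiber x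

variable {σ}

/-- The section is of class `C^r`. -/
def IsCr (r : ℕ∞) (ψ : P.Spinor σ) : Prop :=
  ContMDiff (𝓡 n) ((𝓡 n).prod 𝓘(ℝ, Dbl S)) r
    (fun x => TotalSpace.mk' (Dbl S) (E := (P.spinorBundle σ).Fiber) x (ψ x))

/-- The representative of a spinor in the trivialization with index `a`. -/
def localRep (a : ι) (ψ : P.Spinor σ) (y : M) : Dbl S :=
  (P.spinorBundle σ).coordChange (P.indexAt y) a y (ψ y)

/-- The coefficients `Γ_ijk = g(∇_{e_i} e_j, e_k)` of the Levi-Civita connection in the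
orthonormal frame with index `a`, by the Koszul formula. -/
def connCoeff (a : ι) (x : M) (i j k : Fin n) : ℝ :=
  let br (i j : Fin n) : TangentSpace (𝓡 n) x :=
    VectorField.mlieBracket (𝓡 n) (P.frame a i) (P.frame a j) x
  (g.inner x (br i j) (P.frame a k x) - g.inner x (br j k) (P.frame a i x)
    + g.inner x (br k i) (P.frame a j x)) / 2

/-- The `j`-th coordinate of a tangent vector at `x`, in the frame with index `P.indexAt x`. -/
def coord (x : M) (v : TangentSpace (𝓡 n) x) : EucSp n :=
  WithLp.toLp 2 fun j => g.inner x v (P.frame (P.indexAt x) j x)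

/-- The spin connection on `𝒮 ⊕ 𝒮`: in a local orthonormal frame and the corresponding
trivialization, `∇_v ψ = ∂_v ψ + ¼ ∑_{j,k} g(∇_v e_j, e_k) e_j e_k ψ` on each summand `𝒮`.
At `x` the frame with index `P.indexAt x` is used. -/
def nabla (ψ : P.Spinor σ) (x : M) (v : TangentSpace (𝓡 n) x) : (P.spinorBundle σ).Fiber x :=
  let a := P.indexAt x
  let dψ : TangentSpace (𝓡 n) x →L[ℝ] Dbl S :=
    mfderiv (𝓡 n) 𝓘(ℝ, Dbl S) (P.localRep a ψ) x
  let Ω : Cl n := ∑ i, ∑ j, ∑ k, (P.coord x v i * P.connCoeff a x i j k / 4) •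
    (clι n (EuclideanSpace.single j 1) * clι n (EuclideanSpace.single k 1))
  (dψ v + dblDiag (σ.rep Ω) (ψ x) : Dbl S)

/-- The equation `∇_v ψ = -½ ∑_j k(v, e_j) e_j e₀ ψ - ½ 𝐢 v ψ` for all tangent vectors `v`. -/
def IsKillingSpinor (k : ∀ x : M, TangentSpace (𝓡 n) x →ₗ[ℝ] TangentSpace (𝓡 n) x →ₗ[ℝ] ℝ)
    (ψ : P.Spinor σ) : Prop :=
  ∀ (x : M) (v : TangentSpace (𝓡 n) x),
    P.nabla ψ x v =
      (-(1 / 2 : ℂ) • ∑ j, (k x v (P.frame (P.indexAt x) j x) : ℂ) • σ.e j (e0 (ψ x))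
        - (Complex.I / 2) • σ.cl (P.coord x v) (ψ x) : Dbl S)

/-- The spinor `φ = e₀ (N(ψ) - 𝐢 Y(ψ) + e₀ X(ψ) - ½ 𝐢 e₀ ω(ψ)) ψ`, computed at each point in the
orthonormal frame and trivialization with index `P.indexAt x`; every other index gives the same
element of the fibre because the expression is `Spin(n)`-equivariant. -/
def hiddenSpinor (ψ : P.Spinor σ) : P.Spinor σ := fun x => σ.hidden (ψ x)

end SpinStructure

end Geometry

end

/-! Let `B` be the real symplectic form `Im ⟨e₀ b, a⟩` on `S ⊕ S`. The gamma matrices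
`e₁, …, eₙ, e₀, 𝐢` realize the half-spin representation of `so(n, 2)`, which preserves `B`, and the
equation says that `ψ` is parallel for a connection with values in this Lie algebra. Up to the
factor `-𝐢 / 2`, which commutes with the representation, `φ` is the contraction
`∑ B(ψ, γ_a γ'_b ψ) γ^a γ'^b ψ`, i.e. the image of `ψ` under the cubic map built from `B` and the
Casimir element. Since the Casimir element is invariant, this map commutes with the Lie algebra,
hence preserves parallel sections, and with `Spin(n)`, hence is given by the same formula in all
trivializations. -/

open scoped TensorProduct

section WeylPair

variable {𝕜 A E : Type*} [CommRing 𝕜] [Ring A] [Algebra 𝕜 A]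

lemma sum_smul_sum_smul_comm [Fintype E] {N : Type*} [AddCommGroup N] [Module 𝕜 N] (η : E → 𝕜)
    (f : E → E → N) :
    ∑ a, η a • ∑ b, η b • f a b = ∑ b, η b • ∑ a, η a • f a b := by
  simp only [Finset.smul_sum]
  rw [Finset.sum_comm]
  exact Finset.sum_congr rfl fun b _ => Finset.sum_congr rfl fun a _ => smul_comm _ _ _

variable [DecidableEq E]

/-- Two families of gamma matrices of signature `η` acting between the half-spin spaces of opposite
chirality, which are here identified with each other: `γ a` acts from one to the other and `γ' a`
back. The products `γ a * γ' b` with `a ≠ b` then span the spin representation of `so(η)`. -/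
structure IsWeylPair (η : E → 𝕜) (γ γ' : E → A) : Prop where
  mul_add_mul : ∀ a b, γ a * γ' b + γ b * γ' a = algebraMap 𝕜 A (2 * Matrix.diagonal η a b)
  mul_add_mul' : ∀ a b, γ' a * γ b + γ' b * γ a = algebraMap 𝕜 A (2 * Matrix.diagonal η a b)

/-- The action of twice the generator of the rotations in the `c`-`d` plane on a vector of signature
`η` with entries `x a`. -/
def rotationGenerator {M : Type*} [AddCommGroup M] [Module 𝕜 M] (η : E → 𝕜) (c d : E) (x : E → M)
    (a : E) : M :=
  (2 * Matrix.diagonal η a d) • x c - (2 * Matrix.diagonal η a c) • x d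

variable {η : E → 𝕜} {γ γ' : E → A}

lemma IsWeylPair.symm (h : IsWeylPair η γ γ') : IsWeylPair η γ' γ :=
  ⟨h.mul_add_mul', h.mul_add_mul⟩

lemma IsWeylPair.mul_mul_eq (h : IsWeylPair η γ γ') (c d a : E) :
    γ c * γ' d * γ a = γ a * (γ' c * γ d) + rotationGenerator η c d γ a := by
  have hd : γ' d * γ a = (2 * Matrix.diagonal η a d) • 1 - γ' a * γ d := by
    rw [← Algebra.algebraMap_eq_smul_one, ← h.mul_add_mul' a d, add_sub_cancel_left]
  have hc : γ c * γ' a = (2 * Matrix.diagonal η a c) • 1 - γ a * γ' c := by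
    rw [← Algebra.algebraMap_eq_smul_one, ← h.mul_add_mul a c, add_sub_cancel_left]
  rw [mul_assoc, hd, mul_sub, ← mul_assoc, hc, sub_mul, mul_smul_comm, smul_mul_assoc, mul_one,
    one_mul, mul_assoc, rotationGenerator]
  abel

lemma IsWeylPair.lie_mul (h : IsWeylPair η γ γ') (c d a b : E) :
    ⁅γ c * γ' d, γ a * γ' b⁆ =
      rotationGenerator η c d γ a * γ' b + γ a * rotationGenerator η c d γ' b := by
  rw [Ring.lie_def, ← mul_assoc (γ c * γ' d), h.mul_mul_eq, mul_assoc (γ a) (γ' b),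
    ← sub_eq_of_eq_add' (h.symm.mul_mul_eq c d b)]
  noncomm_ring

variable [Fintype E]

lemma sum_smul_rotationGenerator {M N : Type*} [AddCommGroup M] [Module 𝕜 M] [AddCommGroup N]
    [Module 𝕜 N] (hη : ∀ a, η a * η a = 1) (β : M →ₗ[𝕜] M →ₗ[𝕜] N) (c d : E) (x : E → M) :
    ∑ a, η a • (β (rotationGenerator η c d x a) (x a) + β (x a) (rotationGenerator η c d x a))
      = 0 := by
  have hs (e : E) (y : E → N) : ∑ a, η a • (2 * Matrix.diagonal η a e) • y a = (2 : 𝕜) • y e := by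
    simp [Matrix.diagonal_apply, smul_smul, mul_left_comm _ (2 : 𝕜), hη]
  simp only [rotationGenerator, map_sub, map_smul, LinearMap.sub_apply, LinearMap.smul_apply,
    smul_add, smul_sub, Finset.sum_add_distrib, Finset.sum_sub_distrib, hs]
  abel

lemma sum_smul_isometry {M N : Type*} [AddCommGroup M] [Module 𝕜 M] [AddCommGroup N]
    [Module 𝕜 N] {R : Matrix E E 𝕜} (hR : R.transpose * Matrix.diagonal η * R = Matrix.diagonal η)
    (β : M →ₗ[𝕜] M →ₗ[𝕜] N) (x : E → M) :
    ∑ a, η a • β (∑ c, R a c • x c) (∑ d, R a d • x d) = ∑ a, η a • β (x a) (x a) := by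
  have hcd (c d : E) : ∑ a, η a * (R a c * R a d) = if c = d then η c else 0 := by
    have h := congrFun (congrFun hR c) d
    rw [Matrix.diagonal_apply, Matrix.mul_apply] at h
    simpa only [Matrix.mul_diagonal, Matrix.transpose_apply, mul_comm, mul_left_comm] using h
  calc ∑ a, η a • β (∑ c, R a c • x c) (∑ d, R a d • x d)
      = ∑ d, ∑ c, (∑ a, η a * (R a d * R a c)) • β (x c) (x d) := by
        simp only [map_sum, map_smul, LinearMap.sum_apply, LinearMap.smul_apply, Finset.smul_sum,
          Finset.sum_smul, smul_smul]
        rw [Finset.sum_comm]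
        exact Finset.sum_congr rfl fun d _ => Finset.sum_comm
    _ = ∑ a, η a • β (x a) (x a) := by simp [hcd]

attribute [local instance] LieRing.ofAssociativeRing

/-- The quadratic Casimir element `∑ γ a * γ' b ⊗ γ^a * γ'^b` of the spin representation, including
the scalar terms `a = b`. -/
def casimir (η : E → 𝕜) (γ γ' : E → A) : A ⊗[𝕜] A :=
  ∑ a, η a • ∑ b, η b • (γ a * γ' b) ⊗ₜ (γ a * γ' b)

lemma IsWeylPair.lie_casimir (h : IsWeylPair η γ γ') (hη : ∀ a, η a * η a = 1) (c d : E) :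
    ⁅γ c * γ' d, casimir η γ γ'⁆ = 0 := by
  have hl (b : E) := sum_smul_rotationGenerator hη ((TensorProduct.mk 𝕜 A A).compl₁₂
    (LinearMap.mulRight 𝕜 (γ' b)) (LinearMap.mulRight 𝕜 (γ' b))) c d γ
  have hr (a : E) := sum_smul_rotationGenerator hη ((TensorProduct.mk 𝕜 A A).compl₁₂
    (LinearMap.mulLeft 𝕜 (γ a)) (LinearMap.mulLeft 𝕜 (γ a))) c d γ'
  simp only [LinearMap.compl₁₂_apply, LinearMap.mulRight_apply, LinearMap.mulLeft_apply,
    TensorProduct.mk_apply] at hl hr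
  calc ⁅γ c * γ' d, casimir η γ γ'⁆
      = ∑ a, η a • ∑ b, η b •
            ((rotationGenerator η c d γ a * γ' b) ⊗ₜ[𝕜] (γ a * γ' b)
              + (γ a * γ' b) ⊗ₜ[𝕜] (rotationGenerator η c d γ a * γ' b))
          + ∑ a, η a • ∑ b, η b •
            ((γ a * rotationGenerator η c d γ' b) ⊗ₜ[𝕜] (γ a * γ' b)
              + (γ a * γ' b) ⊗ₜ[𝕜] (γ a * rotationGenerator η c d γ' b)) := by
        simp only [casimir, lie_sum, lie_smul, TensorProduct.LieModule.lie_tmul_right, h.lie_mul,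
          TensorProduct.add_tmul, TensorProduct.tmul_add, ← Finset.sum_add_distrib, ← smul_add]
        simp only [add_add_add_comm]
    _ = 0 := by
        rw [sum_smul_sum_smul_comm]
        simp only [hl, hr, smul_zero, Finset.sum_const_zero, add_zero]

lemma map_casimir {R : Matrix E E 𝕜}
    (hR : R.transpose * Matrix.diagonal η * R = Matrix.diagonal η) {s s' : A} (hs : s * s' = 1)
    (hγ : ∀ a, s' * γ a * s = ∑ c, R a c • γ c) (hγ' : ∀ a, s' * γ' a * s = ∑ c, R a c • γ' c) :
    TensorProduct.map (LinearMap.mulLeftRight 𝕜 (s', s)) (LinearMap.mulLeftRight 𝕜 (s', s))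
      (casimir η γ γ') = casimir η γ γ' := by
  have hconj (a b : E) : s' * (γ a * γ' b) * s = (∑ c, R a c • γ c) * (∑ d, R b d • γ' d) := by
    rw [← hγ, ← hγ']
    simp only [mul_assoc]
    rw [← mul_assoc s s', hs, one_mul]
  have hl (y : A) := sum_smul_isometry hR ((TensorProduct.mk 𝕜 A A).compl₁₂
    (LinearMap.mulRight 𝕜 y) (LinearMap.mulRight 𝕜 y)) γ
  have hr (a : E) := sum_smul_isometry hR ((TensorProduct.mk 𝕜 A A).compl₁₂
    (LinearMap.mulLeft 𝕜 (γ a)) (LinearMap.mulLeft 𝕜 (γ a))) γ'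
  simp only [LinearMap.compl₁₂_apply, LinearMap.mulRight_apply, LinearMap.mulLeft_apply,
    TensorProduct.mk_apply] at hl hr
  simp only [casimir, map_sum, map_smul, TensorProduct.map_tmul, LinearMap.mulLeftRight_apply,
    hconj]
  rw [sum_smul_sum_smul_comm]
  simp only [hl]
  rw [sum_smul_sum_smul_comm]
  simp only [hr]

end WeylPair

section CubicMap

variable {𝕜 A H : Type*} [CommRing 𝕜] [Ring A] [Algebra 𝕜 A] [AddCommGroup H] [Module 𝕜 H]
  [Module A H] [IsScalarTower 𝕜 A H]

/-- The vector field on `H` attached to a tensor `t = ∑ T ⊗ U` of operators: it is cubic in `p`,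
namely `∑ B(p, T p) U p`. -/
def cubicMap (B : LinearMap.BilinForm 𝕜 H) (p : H) : A ⊗[𝕜] A →ₗ[𝕜] H :=
  let orbit : A →ₗ[𝕜] H := (LinearMap.toSpanSingleton A H p).restrictScalars 𝕜
  TensorProduct.lift ((LinearMap.lsmul 𝕜 H).compl₁₂ (B p ∘ₗ orbit) orbit)

lemma cubicMap_tmul (B : LinearMap.BilinForm 𝕜 H) (p : H) (T U : A) :
    cubicMap B p (T ⊗ₜ[𝕜] U) = B p (T • p) • U • p := rfl

lemma cubicMap_smul {B : LinearMap.BilinForm 𝕜 H} {s s' : A} (hs : s * s' = 1)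
    (hB : ∀ u v, B (s • u) v = B u (s' • v)) (p : H) (t : A ⊗[𝕜] A) :
    cubicMap B (s • p) t = s • cubicMap B p (TensorProduct.map
      (LinearMap.mulLeftRight 𝕜 (s', s)) (LinearMap.mulLeftRight 𝕜 (s', s)) t) := by
  have : SMulCommClass 𝕜 A H := IsScalarTower.to_smulCommClass
  induction t with
  | zero => simp only [map_zero, smul_zero]
  | add t u ht hu => simp only [map_add, smul_add, ht, hu]
  | tmul T U =>
    simp only [cubicMap_tmul, TensorProduct.map_tmul, LinearMap.mulLeftRight_apply, hB,
      smul_comm s, smul_smul, ← mul_assoc, hs, one_mul]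

end CubicMap

section Derivative

variable {A H : Type*} [Ring A] [Algebra ℝ A] [NormedAddCommGroup H] [NormedSpace ℝ H]
  [FiniteDimensional ℝ H] [Module A H] [IsScalarTower ℝ A H]

lemma contDiff_cubicMap (B : LinearMap.BilinForm ℝ H) {m : WithTop ℕ∞} (t : A ⊗[ℝ] A) :
    ContDiff ℝ m fun p => cubicMap B p t := by
  induction t with
  | zero => simpa only [map_zero] using contDiff_const
  | add t u ht hu => simpa only [map_add] using ht.add hu
  | tmul T U =>
    have hsmul (T : A) : ContDiff ℝ m fun p : H => T • p :=
      (LinearMap.toContinuousLinearMap (Algebra.lsmul ℝ ℝ H T)).contDiff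
    have hB : ContDiff ℝ m fun q : H × H => B q.1 q.2 :=
      (LinearMap.toContinuousBilinearMap B).isBoundedBilinearMap.contDiff
    exact (hB.comp (contDiff_id.prodMk (hsmul T))).smul (hsmul U)

attribute [local instance] LieRing.ofAssociativeRing

lemma fderiv_cubicMap_apply_smul {B : LinearMap.BilinForm ℝ H} {X : A}
    (hX : ∀ u v, B (X • u) v = -B u (X • v)) (p : H) (t : A ⊗[ℝ] A) :
    fderiv ℝ (fun p => cubicMap B p t) p (X • p) = X • cubicMap B p t - cubicMap B p ⁅X, t⁆ := by
  have : SMulCommClass ℝ A H := IsScalarTower.to_smulCommClass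
  have hdiff (t : A ⊗[ℝ] A) : DifferentiableAt ℝ (fun p => cubicMap B p t) p :=
    (contDiff_cubicMap B t).differentiable one_ne_zero p
  induction t with
  | zero => simp
  | add t u ht hu =>
    simp only [map_add, lie_add, smul_add, fderiv_fun_add (hdiff t) (hdiff u), add_apply, ht, hu]
    abel
  | tmul T U =>
    have hsmul (T : A) :=
      (LinearMap.toContinuousLinearMap (Algebra.lsmul ℝ ℝ H T)).hasFDerivAt (x := p)
    have hB := (LinearMap.toContinuousBilinearMap B).hasFDerivAt_of_bilinear
      (hasFDerivAt_id p) (hsmul T)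
    have hderiv : fderiv ℝ (fun p => cubicMap B p (T ⊗ₜ[ℝ] U)) p (X • p) =
        B p (T • p) • U • X • p + (B p (T • X • p) + B (X • p) (T • p)) • U • p := by
      refine (DFunLike.congr_fun (hB.smul (hsmul U)).fderiv (X • p)).trans ?_
      simp
    rw [hderiv, hX]
    simp only [cubicMap_tmul, TensorProduct.LieModule.lie_tmul_right, Ring.lie_def, map_add,
      sub_smul, mul_smul, map_sub, smul_sub, add_smul, neg_smul, smul_comm X]
    abel

end Derivative

section Casimir

variable {𝕜 A H E : Type*} [CommRing 𝕜] [Ring A] [Algebra 𝕜 A] [AddCommGroup H] [Module 𝕜 H]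
  [Module A H] {B : LinearMap.BilinForm 𝕜 H} {η : E → 𝕜} {γ γ' : E → A}

/-- The image of `so(η)` in the spin representation given by a pair of families of gamma
matrices. -/
def spinGenerators (𝕜 : Type*) {A E : Type*} [CommRing 𝕜] [Ring A] [Algebra 𝕜 A] (γ γ' : E → A) :
    Submodule 𝕜 A :=
  Submodule.span 𝕜 {X | ∃ c d, c ≠ d ∧ γ c * γ' d = X}

lemma mul_mem_spinGenerators {c d : E} (hcd : c ≠ d) : γ c * γ' d ∈ spinGenerators 𝕜 γ γ' :=
  Submodule.subset_span ⟨c, d, hcd, rfl⟩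

lemma IsWeylPair.form_mul_smul [DecidableEq E] (h : IsWeylPair η γ γ') (hB : B.IsAlt)
    (hγ : ∀ a u v, B (γ a • u) v = B u (γ' a • v)) {c d : E} (hcd : c ≠ d) (u v : H) :
    B ((γ c * γ' d) • u) v = -B u ((γ c * γ' d) • v) := by
  have hγ' : B (γ' d • u) (γ' c • v) = B u (γ d • γ' c • v) := by
    rw [← LinearMap.IsAlt.neg hB, ← hγ, LinearMap.IsAlt.neg hB]
  have hswap : γ d * γ' c = -(γ c * γ' d) := by
    rw [eq_neg_iff_add_eq_zero, h.mul_add_mul, Matrix.diagonal_apply_ne' _ hcd, mul_zero, map_zero]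
  rw [mul_smul, hγ, hγ', ← mul_smul, hswap, neg_smul, map_neg]

variable [IsScalarTower 𝕜 A H]

/-- The cubic vector field of the Casimir element. -/
def casimirMap [Fintype E] (B : LinearMap.BilinForm 𝕜 H) (η : E → 𝕜) (γ γ' : E → A) (p : H) : H :=
  cubicMap B p (casimir η γ γ')

lemma casimirMap_eq_sum [Fintype E] (p : H) :
    casimirMap B η γ γ' p =
      ∑ a, ∑ b, (η a * η b * B p ((γ a * γ' b) • p)) • (γ a * γ' b) • p := by
  simp only [casimirMap, casimir, map_sum, map_smul, cubicMap_tmul, Finset.smul_sum, mul_smul]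

end Casimir

section CasimirDerivative

variable {A H E : Type*} [Ring A] [Algebra ℝ A] [NormedAddCommGroup H] [NormedSpace ℝ H]
  [FiniteDimensional ℝ H] [Module A H] [IsScalarTower ℝ A H] [Fintype E] [DecidableEq E]
  {B : LinearMap.BilinForm ℝ H} {η : E → ℝ} {γ γ' : E → A}

lemma IsWeylPair.fderiv_casimirMap_apply_smul (h : IsWeylPair η γ γ') (hη : ∀ a, η a * η a = 1)
    (hB : B.IsAlt) (hγ : ∀ a u v, B (γ a • u) v = B u (γ' a • v)) {X : A}
    (hX : X ∈ spinGenerators ℝ γ γ') (p : H) :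
    fderiv ℝ (casimirMap B η γ γ') p (X • p) = X • casimirMap B η γ γ' p := by
  have : SMulCommClass ℝ A H := IsScalarTower.to_smulCommClass
  induction hX using Submodule.span_induction with
  | mem X hX =>
    obtain ⟨c, d, hcd, rfl⟩ := hX
    refine (fderiv_cubicMap_apply_smul (h.form_mul_smul hB hγ hcd) p _).trans ?_
    rw [h.lie_casimir hη, map_zero, sub_zero, casimirMap]
  | zero => simp only [zero_smul, map_zero]
  | add X Y _ _ hX hY => simp only [add_smul, map_add, hX, hY]
  | smul r X _ hX => simp only [smul_assoc, map_smul, hX]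

end CasimirDerivative

noncomputable section

section CliffordAlgebra

variable (n : ℕ)

lemma polar_negForm (v w : EucSp n) :
    QuadraticMap.polar (negForm n) v w = -2 * ⟪v, w⟫_ℝ := by
  rw [negForm, FunLike.coe_neg, QuadraticMap.polar_neg, LinearMap.BilinMap.polar_toQuadraticMap,
    innerₗ_apply_apply, innerₗ_apply_apply, real_inner_comm]
  ring

lemma clι_mul_clι_add_swap (v w : EucSp n) :
    clι n v * clι n w + clι n w * clι n v = algebraMap ℝ (Cl n) (-2 * ⟪v, w⟫_ℝ) := by
  rw [CliffordAlgebra.ι_mul_ι_add_swap, polar_negForm]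

lemma eucSp_eq_sum (v : EucSp n) : v = ∑ i, v i • EuclideanSpace.single i (1 : ℝ) := by
  simpa using ((EuclideanSpace.basisFun (Fin n) ℝ).sum_repr v).symm

variable {n}

lemma exists_orthogonal_of_mem_spinGroup {x : Cl n} (hx : x ∈ spinGroup (negForm n)) :
    ∃ R : Matrix (Fin n) (Fin n) ℝ, R * R.transpose = 1 ∧
      ∀ i, star x * clι n (EuclideanSpace.single i 1) * x = clι n (WithLp.toLp 2 (R i)) := by
  have hstar := spinGroup.star_mul_self_of_mem hx
  have hself := spinGroup.mul_star_self_of_mem hx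
  have hrange (v : EucSp n) : ∃ w, clι n w = star x * clι n v * x := by
    have := spinGroup.conjAct_smul_ι_mem_range_ι
      (x := ⟨star x, x, hstar, hself⟩) (spinGroup.star_mem hx) v
    simpa [ConjAct.units_smul_def] using this
  choose f hf using hrange
  refine ⟨Matrix.of fun i j => f (EuclideanSpace.single i 1) j, ?_, fun i => (hf _).symm⟩
  have hinner (v w : EucSp n) : ⟪f v, f w⟫_ℝ = ⟪v, w⟫_ℝ := by
    have hmul (v w : EucSp n) :
        clι n (f v) * clι n (f w) = star x * (clι n v * clι n w) * x := by
      rw [hf, hf]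
      simp only [mul_assoc]
      rw [← mul_assoc x (star x), hself, one_mul]
    have h := clι_mul_clι_add_swap n (f v) (f w)
    rw [hmul, hmul, ← add_mul, ← mul_add, clι_mul_clι_add_swap, ← Algebra.commutes, mul_assoc,
      hstar, mul_one] at h
    have := FaithfulSMul.algebraMap_injective ℝ (Cl n) h
    linarith
  ext i j
  rw [Matrix.mul_apply, Matrix.one_apply]
  simpa [PiLp.inner_apply, mul_comm, PiLp.single_apply, eq_comm] using
    hinner (EuclideanSpace.single i 1) (EuclideanSpace.single j 1)

end CliffordAlgebra

section SpinorModule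

variable {n : ℕ} {S : Type*} [NormedAddCommGroup S] [InnerProductSpace ℂ S]

lemma e0_mul_e0 : (e0 * e0 : Module.End ℂ (Dbl S)) = 1 := rfl

lemma e0_e0 (p : Dbl S) : e0 (e0 p) = p := rfl

lemma inner_e0_left (a b : Dbl S) : ⟪e0 a, b⟫_ℂ = ⟪a, e0 b⟫_ℂ := by
  rw [WithLp.prod_inner_apply, WithLp.prod_inner_apply]
  exact add_comm _ _

variable (S) in
/-- The real symplectic form `Im ⟨e₀ b, a⟩` on `S ⊕ S`, which is invariant under `Spin(n, 2)`. -/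
def dblForm : LinearMap.BilinForm ℝ (Dbl S) :=
  LinearMap.mk₂ ℝ (fun a b => (⟪a, e0 b⟫_ℂ).im)
    (fun a a' b => by simp only [inner_add_left, Complex.add_im])
    (fun c a b => by
      rw [← Complex.coe_smul, inner_smul_left, Complex.conj_ofReal, Complex.im_ofReal_mul,
        smul_eq_mul])
    (fun a b b' => by simp only [map_add, inner_add_right, Complex.add_im])
    (fun c a b => by
      rw [← Complex.coe_smul, map_smul, inner_smul_right, Complex.im_ofReal_mul, smul_eq_mul])

lemma dblForm_apply (a b : Dbl S) : dblForm S a b = (⟪a, e0 b⟫_ℂ).im := rfl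

lemma isAlt_dblForm : (dblForm S).IsAlt := fun p => by
  rw [dblForm_apply]
  exact Complex.conj_eq_iff_im.1 (by rw [inner_conj_symm, inner_e0_left])

namespace SpinorModule

variable (σ : SpinorModule n S)

lemma inner_rep_left (x : Cl n) (a b : S) : ⟪σ.rep x a, b⟫_ℂ = ⟪a, σ.rep (star x) b⟫_ℂ := by
  induction x using CliffordAlgebra.induction generalizing a b with
  | algebraMap r =>
    rw [CliffordAlgebra.star_algebraMap, AlgHom.commutes, Module.algebraMap_end_apply,
      Module.algebraMap_end_apply, ← Complex.coe_smul, ← Complex.coe_smul, inner_smul_left,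
      inner_smul_right, Complex.conj_ofReal]
  | ι v =>
    rw [CliffordAlgebra.star_ι, map_neg, LinearMap.neg_apply, inner_neg_right]
    exact σ.skew v a b
  | mul x y hx hy =>
    rw [star_mul, map_mul, map_mul, Module.End.mul_apply, Module.End.mul_apply, hx, hy]
  | add x y hx hy =>
    rw [star_add, map_add, map_add, LinearMap.add_apply, LinearMap.add_apply, inner_add_left,
      inner_add_right, hx, hy]

/-- The diagonal action of `Cl(n)` on `S ⊕ S`. -/
def diag : Cl n →ₐ[ℝ] Module.End ℂ (Dbl S) :=
  AlgHom.ofLinearMap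
    { toFun := fun x => dblMap (σ.rep x) (σ.rep x)
      map_add' := fun x y => by rw [map_add]; rfl
      map_smul' := fun c x => by rw [map_smul]; rfl }
    (by simp [dblMap_one]) (fun x y => by simp [dblMap_mul])

lemma diag_apply (x : Cl n) : σ.diag x = dblMap (σ.rep x) (σ.rep x) := rfl

lemma inner_diag_left (x : Cl n) (a b : Dbl S) : ⟪σ.diag x a, b⟫_ℂ = ⟪a, σ.diag (star x) b⟫_ℂ := by
  rw [WithLp.prod_inner_apply, WithLp.prod_inner_apply]
  exact congrArg₂ (· + ·) (σ.inner_rep_left x _ _) (σ.inner_rep_left x _ _)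

/-- The involution `(a, b) ↦ (a, -b)` of `S ⊕ S`. -/
def grading (S : Type*) [NormedAddCommGroup S] [InnerProductSpace ℂ S] : Module.End ℂ (Dbl S) :=
  dblMap 1 (-1)

lemma grading_mul_e0 : grading S * e0 = -(e0 * grading S) := by
  ext p
  refine WithLp.ofLp_injective 2 (Prod.ext ?_ ?_)
  · exact (neg_neg _).symm
  · rfl

lemma commute_grading_diag (x : Cl n) : Commute (grading S) (σ.diag x) := by
  simp [Commute, SemiconjBy, grading, diag_apply, dblMap_mul]

lemma commute_e0_diag (x : Cl n) : Commute e0 (σ.diag x) := rfl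

lemma cl_eq_grading_mul_diag (v : EucSp n) : σ.cl v = grading S * σ.diag (clι n v) := by
  simp [cl, grading, diag_apply, dblMap_mul]

lemma cl_mul_cl (v w : EucSp n) : σ.cl v * σ.cl w = σ.diag (clι n v * clι n w) := by
  rw [cl, cl, dblMap_mul, neg_mul_neg, diag_apply, map_mul]

lemma cl_mul_cl_add_swap (v w : EucSp n) :
    σ.cl v * σ.cl w + σ.cl w * σ.cl v = algebraMap ℝ _ (-2 * ⟪v, w⟫_ℝ) := by
  rw [cl_mul_cl, cl_mul_cl, ← AlgHom.commutes σ.diag, ← clι_mul_clι_add_swap]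
  exact (map_add σ.diag _ _).symm

lemma cl_mul_e0 (v : EucSp n) : σ.cl v * e0 = -(e0 * σ.cl v) := by
  rw [cl_eq_grading_mul_diag, mul_assoc, ← σ.commute_e0_diag, ← mul_assoc, grading_mul_e0,
    neg_mul, mul_assoc]

lemma cl_eq_sum (v : EucSp n) : σ.cl v = ∑ i, v i • σ.e i := by
  conv_lhs => rw [eucSp_eq_sum n v]
  simp only [e, cl_eq_grading_mul_diag, map_sum, map_smul, Finset.mul_sum, mul_smul_comm]

lemma inner_cl_left (v : EucSp n) (a b : Dbl S) : ⟪σ.cl v a, b⟫_ℂ = -⟪a, σ.cl v b⟫_ℂ := by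
  simp [cl, dblMap, WithLp.prod_inner_apply, σ.skew, add_comm]

lemma inner_cl_e0 (v : EucSp n) (a b : Dbl S) :
    ⟪σ.cl v a, e0 b⟫_ℂ = ⟪a, e0 (σ.cl v b)⟫_ℂ := by
  rw [inner_cl_left, ← Module.End.mul_apply, cl_mul_e0, LinearMap.neg_apply, inner_neg_right,
    neg_neg, Module.End.mul_apply]

/-- The signature `(n, 2)`: `e_i ^ 2 = -1` for `1 ≤ i ≤ n`, while `e₀ ^ 2 = 1` and `𝐢 * -𝐢 = 1`. -/
def signature (n : ℕ) : Fin n ⊕ Fin 2 → ℝ := Sum.elim (fun _ => -1) (fun _ => 1)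

lemma signature_mul_self (a : Fin n ⊕ Fin 2) : signature n a * signature n a = 1 := by
  rcases a with i | i <;> simp [signature]

/-- The gamma matrices `e₁, …, eₙ, e₀, 𝐢` of `so(n, 2)`, acting on `S ⊕ S` as a half-spin space. -/
def gamma : Fin n ⊕ Fin 2 → Module.End ℂ (Dbl S) := Sum.elim σ.e ![e0, Complex.I • 1]

/-- The gamma matrices `e₁, …, eₙ, e₀, -𝐢` of the opposite chirality. -/
def gamma' : Fin n ⊕ Fin 2 → Module.End ℂ (Dbl S) := Sum.elim σ.e ![e0, -(Complex.I • 1)]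

lemma isWeylPair_gamma : IsWeylPair (signature n) σ.gamma σ.gamma' := by
  have he (i j : Fin n) : σ.e i * σ.e j + σ.e j * σ.e i =
      algebraMap ℝ _ (2 * Matrix.diagonal (signature n) (.inl i) (.inl j)) := by
    rw [e, e, cl_mul_cl_add_swap, EuclideanSpace.inner_single_left, Matrix.diagonal_apply]
    congr 1
    by_cases hij : i = j <;> simp [hij, signature]
  have he0 (i : Fin n) : σ.e i * e0 = -(e0 * σ.e i) := σ.cl_mul_e0 _
  have h2 : (1 : Module.End ℂ (Dbl S)) + 1 = algebraMap ℝ _ 2 := by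
    rw [one_add_one_eq_two, map_ofNat]
  constructor
  · rintro (i | i) (j | j)
    · exact he i j
    · fin_cases j <;> simp [gamma, gamma', he0]
    · fin_cases i <;> simp [gamma, gamma', he0]
    · fin_cases i <;> fin_cases j <;> simp [gamma, gamma', signature, e0_mul_e0, smul_smul, h2]
  · rintro (i | i) (j | j)
    · exact he i j
    · fin_cases j <;> simp [gamma, gamma', he0]
    · fin_cases i <;> simp [gamma, gamma', he0]
    · fin_cases i <;> fin_cases j <;> simp [gamma, gamma', signature, e0_mul_e0, smul_smul, h2]

lemma dblForm_gamma_smul (a : Fin n ⊕ Fin 2) (u v : Dbl S) :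
    dblForm S (σ.gamma a • u) v = dblForm S u (σ.gamma' a • v) := by
  suffices ⟪σ.gamma a u, e0 v⟫_ℂ = ⟪u, e0 (σ.gamma' a v)⟫_ℂ from congrArg Complex.im this
  rcases a with i | i
  · exact σ.inner_cl_e0 _ u v
  · fin_cases i
    · exact inner_e0_left u (e0 v)
    · simp only [gamma, gamma', Fin.mk_one, Sum.elim_inr, Matrix.cons_val_one,
        Matrix.cons_val_fin_one, LinearMap.neg_apply, LinearMap.smul_apply, Module.End.one_apply,
        map_neg, map_smul, inner_neg_right, inner_smul_left, inner_smul_right, Complex.conj_I,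
        neg_mul]

lemma hidden_apply (p : Dbl S) :
    σ.hidden p = (N p : ℂ) • e0 p - Complex.I • e0 (σ.cl (σ.Y p) p) + σ.cl (σ.X p) p
      - (Complex.I / 2) • σ.clom p p := by
  simp only [hidden, Module.End.mul_apply, LinearMap.sub_apply, LinearMap.add_apply,
    LinearMap.smul_apply, Module.End.one_apply, map_sub, map_add, map_smul, e0_e0]

lemma e0_e (i : Fin n) (q : Dbl S) : e0 (σ.e i q) = -σ.e i (e0 q) := by
  rw [eq_neg_iff_add_eq_zero, ← neg_eq_iff_add_eq_zero]
  exact (LinearMap.congr_fun (σ.cl_mul_e0 (EuclideanSpace.single i 1)) q).symm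

lemma dblForm_self_I_smul_e0 (p : Dbl S) : dblForm S p (Complex.I • e0 p) = N p := by
  rw [dblForm_apply, map_smul, e0_e0, inner_smul_right, inner_self_eq_norm_sq_to_K]
  simp [N, ← Complex.ofReal_pow]

lemma dblForm_self_e_e0 (p : Dbl S) (i : Fin n) : dblForm S p (σ.e i (e0 p)) = σ.Y p i := by
  simp [dblForm_apply, e0_e, e0_e0, Y, herm]

lemma dblForm_self_I_smul_e (p : Dbl S) (i : Fin n) :
    dblForm S p (Complex.I • σ.e i p) = -σ.X p i := by
  simp [dblForm_apply, e0_e, X, herm, inner_smul_right]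

lemma dblForm_self_e_e (p : Dbl S) (i j : Fin n) :
    dblForm S p (σ.e i (σ.e j p)) = σ.om p i j := by
  simp [dblForm_apply, e0_e, om, herm]

lemma casimirMap_gamma (p : Dbl S) :
    casimirMap (dblForm S) (signature n) σ.gamma σ.gamma' p = σ.clom p p +
      (2 * Complex.I) •
        ((N p : ℂ) • e0 p - Complex.I • e0 (σ.cl (σ.Y p) p) + σ.cl (σ.X p) p) := by
  have hII (q : Dbl S) : Complex.I • Complex.I • q = -q := by
    rw [smul_smul, Complex.I_mul_I, neg_one_smul]
  have hp : dblForm S p p = 0 := isAlt_dblForm p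
  have hclX : σ.cl (σ.X p) p = ∑ i, σ.X p i • σ.e i p := by
    rw [cl_eq_sum, LinearMap.sum_apply]
    rfl
  have hclY : e0 (σ.cl (σ.Y p) p) = -∑ i, σ.Y p i • σ.e i (e0 p) := by
    rw [cl_eq_sum, LinearMap.sum_apply, map_sum, ← Finset.sum_neg_distrib]
    refine Finset.sum_congr rfl fun i _ => ?_
    rw [LinearMap.smul_apply, LinearMap.map_smul_of_tower, e0_e, smul_neg]
  have hclom : σ.clom p p = ∑ i, ∑ j, σ.om p i j • σ.e i (σ.e j p) := by
    simp only [clom, LinearMap.sum_apply]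
    rfl
  rw [casimirMap_eq_sum, hclX, hclY, hclom]
  simp only [Fintype.sum_sum_type, Fin.sum_univ_two, gamma, gamma', signature, Sum.elim_inl,
    Sum.elim_inr, Matrix.cons_val_zero, Matrix.cons_val_one, Module.End.smul_def,
    Module.End.mul_apply, LinearMap.neg_apply, LinearMap.smul_apply, Module.End.one_apply, map_neg,
    map_smul, e0_e, e0_e0, hII, hp, dblForm_self_I_smul_e0, dblForm_self_e_e0,
    dblForm_self_I_smul_e, dblForm_self_e_e, neg_mul, one_mul, mul_neg, neg_neg, mul_one]
  simp only [zero_smul, neg_smul, smul_neg, neg_neg, smul_comm _ Complex.I, hII,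
    Finset.sum_add_distrib, Finset.sum_neg_distrib, ← Finset.smul_sum, mul_smul, smul_add,
    smul_sub, two_smul, Complex.coe_smul]
  abel

lemma hidden_eq_casimirMap (p : Dbl S) :
    σ.hidden p = -(Complex.I / 2) • casimirMap (dblForm S) (signature n) σ.gamma σ.gamma' p := by
  have hI : -(Complex.I / 2) * (2 * Complex.I) = 1 := by
    linear_combination -Complex.I_mul_I
  rw [hidden_apply, casimirMap_gamma, smul_add, smul_smul, hI, one_smul, neg_smul]
  abel

lemma fromBlocks_isometry_signature {R : Matrix (Fin n) (Fin n) ℝ} (hR : R * R.transpose = 1) :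
    (Matrix.fromBlocks R 0 0 1).transpose * Matrix.diagonal (signature n) *
      Matrix.fromBlocks R 0 0 (1 : Matrix (Fin 2) (Fin 2) ℝ) = Matrix.diagonal (signature n) := by
  have hη : Matrix.diagonal (signature n) =
      Matrix.fromBlocks (-1 : Matrix (Fin n) (Fin n) ℝ) 0 0 (1 : Matrix (Fin 2) (Fin 2) ℝ) := by
    rw [signature, ← Matrix.fromBlocks_diagonal, Matrix.diagonal_one]
    exact congrArg (Matrix.fromBlocks · 0 0 1) (Matrix.diagonal_neg 1).symm
  rw [hη, Matrix.fromBlocks_transpose, Matrix.fromBlocks_multiply, Matrix.fromBlocks_multiply]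
  simp [mul_eq_one_comm.1 hR]

lemma diag_star_mul_e_mul_diag {x : Cl n} {R : Matrix (Fin n) (Fin n) ℝ}
    (hR : ∀ i, star x * clι n (EuclideanSpace.single i 1) * x = clι n (WithLp.toLp 2 (R i)))
    (i : Fin n) : σ.diag (star x) * σ.e i * σ.diag x = ∑ j, R i j • σ.e j := by
  rw [e, cl_eq_grading_mul_diag, ← mul_assoc, ← (σ.commute_grading_diag _).eq, mul_assoc,
    mul_assoc, ← map_mul, ← map_mul, ← mul_assoc, hR, ← cl_eq_grading_mul_diag, cl_eq_sum]

lemma diag_star_mul_sumElim_mul_diag {x : Cl n} (hx : x ∈ spinGroup (negForm n))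
    {R : Matrix (Fin n) (Fin n) ℝ}
    (hR : ∀ i, star x * clι n (EuclideanSpace.single i 1) * x = clι n (WithLp.toLp 2 (R i)))
    {f : Fin 2 → Module.End ℂ (Dbl S)} (hf : ∀ i, Commute (f i) (σ.diag x)) (a : Fin n ⊕ Fin 2) :
    σ.diag (star x) * Sum.elim σ.e f a * σ.diag x =
      ∑ c, Matrix.fromBlocks R 0 0 1 a c • Sum.elim σ.e f c := by
  rw [Fintype.sum_sum_type]
  rcases a with i | i
  · simp only [Sum.elim_inl, Sum.elim_inr, Matrix.fromBlocks_apply₁₁, Matrix.fromBlocks_apply₁₂,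
      Matrix.zero_apply, zero_smul, Finset.sum_const_zero, add_zero,
      σ.diag_star_mul_e_mul_diag hR]
  · simp only [Sum.elim_inl, Sum.elim_inr, Matrix.fromBlocks_apply₂₁, Matrix.fromBlocks_apply₂₂,
      Matrix.zero_apply, zero_smul, Finset.sum_const_zero, zero_add, Matrix.one_apply, ite_smul,
      one_smul, Finset.sum_ite_eq, Finset.mem_univ, if_true]
    rw [mul_assoc, (hf i).eq, ← mul_assoc, ← map_mul, spinGroup.star_mul_self_of_mem hx, map_one,
      one_mul]

lemma hidden_diag {x : Cl n} (hx : x ∈ spinGroup (negForm n)) (p : Dbl S) :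
    σ.hidden (σ.diag x p) = σ.diag x (σ.hidden p) := by
  have hunit : σ.diag x * σ.diag (star x) = 1 := by
    rw [← map_mul, spinGroup.mul_star_self_of_mem hx, map_one]
  have hform (u v : Dbl S) :
      dblForm S (σ.diag x • u) v = dblForm S u (σ.diag (star x) • v) :=
    congrArg Complex.im (σ.inner_diag_left x u (e0 v))
  have hI : Commute (Complex.I • 1) (σ.diag x) := (Commute.one_left _).smul_left _
  obtain ⟨R, hR, hconj⟩ := exists_orthogonal_of_mem_spinGroup hx
  have hcas := map_casimir (γ := σ.gamma) (γ' := σ.gamma') (fromBlocks_isometry_signature hR) hunit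
    (σ.diag_star_mul_sumElim_mul_diag hx hconj
      (Fin.forall_fin_two.2 ⟨σ.commute_e0_diag x, hI⟩))
    (σ.diag_star_mul_sumElim_mul_diag hx hconj
      (Fin.forall_fin_two.2 ⟨σ.commute_e0_diag x, hI.neg_left⟩))
  rw [hidden_eq_casimirMap, hidden_eq_casimirMap, map_smul]
  refine congrArg (-(Complex.I / 2) • ·) ((cubicMap_smul hunit hform p _).trans ?_)
  exact congrArg (fun t => σ.diag x (cubicMap (dblForm S) p t)) hcas

lemma e_mul_e0_mem_spinGenerators (i : Fin n) :
    σ.e i * e0 ∈ spinGenerators ℝ σ.gamma σ.gamma' :=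
  mul_mem_spinGenerators (γ := σ.gamma) (γ' := σ.gamma') (Sum.inl_ne_inr (a := i) (b := 0))

lemma I_smul_cl_mem_spinGenerators (v : EucSp n) :
    Complex.I • σ.cl v ∈ spinGenerators ℝ σ.gamma σ.gamma' := by
  rw [cl_eq_sum, Finset.smul_sum]
  refine Submodule.sum_mem _ fun i _ => ?_
  rw [smul_comm]
  exact Submodule.smul_mem _ _
    (mul_mem_spinGenerators (γ := σ.gamma) (γ' := σ.gamma') (Sum.inr_ne_inl (a := i) (b := 1)))

lemma diag_mul_mem_spinGenerators {i j : Fin n} (hij : i ≠ j) :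
    σ.diag (clι n (EuclideanSpace.single i 1) * clι n (EuclideanSpace.single j 1)) ∈
      spinGenerators ℝ σ.gamma σ.gamma' := by
  rw [← cl_mul_cl]
  exact mul_mem_spinGenerators (γ := σ.gamma) (γ' := σ.gamma') (Sum.inl_injective.ne hij)

variable [FiniteDimensional ℂ S]

lemma contDiff_hidden {m : WithTop ℕ∞} : ContDiff ℝ m σ.hidden := by
  have : FiniteDimensional ℝ (Dbl S) := FiniteDimensional.complexToReal _
  rw [funext σ.hidden_eq_casimirMap]
  exact (contDiff_cubicMap _ _).const_smul _

lemma fderiv_hidden_apply_of_mem {X : Module.End ℂ (Dbl S)}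
    (hX : X ∈ spinGenerators ℝ σ.gamma σ.gamma') (p : Dbl S) :
    fderiv ℝ σ.hidden p (X p) = X (σ.hidden p) := by
  have : FiniteDimensional ℝ (Dbl S) := FiniteDimensional.complexToReal _
  have hdiff : DifferentiableAt ℝ (casimirMap (dblForm S) (signature n) σ.gamma σ.gamma') p :=
    (contDiff_cubicMap _ _).differentiable one_ne_zero p
  have hcas := σ.isWeylPair_gamma.fderiv_casimirMap_apply_smul signature_mul_self isAlt_dblForm
    σ.dblForm_gamma_smul hX p
  rw [funext σ.hidden_eq_casimirMap, fderiv_fun_const_smul hdiff, map_smul]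
  exact congrArg (-(Complex.I / 2) • ·) hcas

end SpinorModule

end SpinorModule

section SpinStructure

variable {n : ℕ} {M : Type*} [TopologicalSpace M] [ChartedSpace (EucSp n) M]
  [IsManifold (𝓡 n) ∞ M] {g : RMetric n M} {ι : Type*} {S : Type*} [NormedAddCommGroup S]
  [InnerProductSpace ℂ S]

namespace SpinStructure

variable (P : SpinStructure g ι)

lemma connCoeff_swap (a : ι) (x : M) (i j k : Fin n) :
    P.connCoeff a x i j k = -P.connCoeff a x i k j := by
  have hbr (i j k : Fin n) :
      g.inner x (VectorField.mlieBracket (𝓡 n) (P.frame a i) (P.frame a j) x) (P.frame a k x) =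
        -g.inner x (VectorField.mlieBracket (𝓡 n) (P.frame a j) (P.frame a i) x)
          (P.frame a k x) := by
    rw [VectorField.mlieBracket_swap_apply, map_neg, neg_apply]
  rw [connCoeff, connCoeff, hbr i k j, hbr k j i, hbr j i k]
  ring

/-- The value at `v` of the `Cl(n)`-valued one-form `¼ ∑ g(∇ e_j, e_k) e_j e_k` of the spin
connection. -/
def spinForm (x : M) (v : TangentSpace (𝓡 n) x) : Cl n :=
  ∑ i, ∑ j, ∑ k, (P.coord x v i * P.connCoeff (P.indexAt x) x i j k / 4) •
    (clι n (EuclideanSpace.single j 1) * clι n (EuclideanSpace.single k 1))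

/-- The value at `v` of the one-form `A` for which the Killing equation in the trivialization
with index `P.indexAt x` reads `∂_v ψ = A(v) ψ`. -/
def killingForm (σ : SpinorModule n S)
    (k : ∀ x : M, TangentSpace (𝓡 n) x →ₗ[ℝ] TangentSpace (𝓡 n) x →ₗ[ℝ] ℝ) (x : M)
    (v : TangentSpace (𝓡 n) x) : Module.End ℂ (Dbl S) :=
  -((1 / 2 : ℝ) • ∑ j, k x v (P.frame (P.indexAt x) j x) • (σ.e j * e0))
    - (1 / 2 : ℝ) • Complex.I • σ.cl (P.coord x v) - σ.diag (P.spinForm x v)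

lemma killingForm_apply (σ : SpinorModule n S)
    (k : ∀ x : M, TangentSpace (𝓡 n) x →ₗ[ℝ] TangentSpace (𝓡 n) x →ₗ[ℝ] ℝ) (x : M)
    (v : TangentSpace (𝓡 n) x) (p : Dbl S) :
    P.killingForm σ k x v p =
      -(1 / 2 : ℂ) • ∑ j, (k x v (P.frame (P.indexAt x) j x) : ℂ) • σ.e j (e0 p)
        - (Complex.I / 2) • σ.cl (P.coord x v) p - σ.diag (P.spinForm x v) p := by
  have hhalf (q : Dbl S) : (1 / 2 : ℝ) • q = (1 / 2 : ℂ) • q := by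
    rw [← Complex.coe_smul]
    norm_num
  have hI : Complex.I / 2 = 1 / 2 * Complex.I := by ring
  simp only [hI, mul_smul, neg_smul, ← hhalf, Complex.coe_smul]
  rw [killingForm, LinearMap.sub_apply, LinearMap.sub_apply, LinearMap.neg_apply,
    LinearMap.smul_apply, LinearMap.sum_apply]
  rfl

lemma diag_spinForm_mem_spinGenerators (σ : SpinorModule n S) (x : M)
    (v : TangentSpace (𝓡 n) x) :
    σ.diag (P.spinForm x v) ∈ spinGenerators ℝ σ.gamma σ.gamma' := by
  simp only [spinForm, map_sum, map_smul]
  refine Submodule.sum_mem _ fun i _ => Submodule.sum_mem _ fun j _ =>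
    Submodule.sum_mem _ fun l _ => ?_
  rcases eq_or_ne j l with rfl | hjl
  · rw [self_eq_neg.1 (P.connCoeff_swap (P.indexAt x) x i j j), mul_zero, zero_div, zero_smul]
    exact Submodule.zero_mem _
  · exact Submodule.smul_mem _ _ (σ.diag_mul_mem_spinGenerators hjl)

lemma killingForm_mem_spinGenerators (σ : SpinorModule n S)
    (k : ∀ x : M, TangentSpace (𝓡 n) x →ₗ[ℝ] TangentSpace (𝓡 n) x →ₗ[ℝ] ℝ) (x : M)
    (v : TangentSpace (𝓡 n) x) :
    P.killingForm σ k x v ∈ spinGenerators ℝ σ.gamma σ.gamma' := by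
  refine Submodule.sub_mem _ (Submodule.sub_mem _
    (Submodule.neg_mem _ (Submodule.smul_mem _ _ ?_))
    (Submodule.smul_mem _ _ (σ.I_smul_cl_mem_spinGenerators _)))
    (P.diag_spinForm_mem_spinGenerators σ x v)
  exact Submodule.sum_mem _ fun j _ => Submodule.smul_mem _ _ (σ.e_mul_e0_mem_spinGenerators j)

variable [FiniteDimensional ℂ S] {σ : SpinorModule n S}

lemma isKillingSpinor_iff
    (k : ∀ x : M, TangentSpace (𝓡 n) x →ₗ[ℝ] TangentSpace (𝓡 n) x →ₗ[ℝ] ℝ) (ψ : P.Spinor σ) :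
    P.IsKillingSpinor k ψ ↔ ∀ (x : M) (v : TangentSpace (𝓡 n) x),
      (mfderiv (𝓡 n) 𝓘(ℝ, Dbl S) (P.localRep (P.indexAt x) ψ) x v : Dbl S) =
        P.killingForm σ k x v (ψ x : Dbl S) := by
  refine forall₂_congr fun x v => ?_
  refine Iff.trans ?_ (Eq.congr_right (P.killingForm_apply σ k x v (ψ x))).symm
  exact (eq_sub_iff_add_eq (G := Dbl S)).symm

lemma localRep_indexAt (ψ : P.Spinor σ) (x : M) : P.localRep (P.indexAt x) ψ x = ψ x :=
  (P.spinorBundle σ).coordChange_self _ x (P.mem_baseSet_at x) _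

lemma isCr_iff (r : ℕ∞) (ψ : P.Spinor σ) :
    P.IsCr r ψ ↔ ∀ x, ContMDiffAt (𝓡 n) 𝓘(ℝ, Dbl S) r (P.localRep (P.indexAt x) ψ) x :=
  forall_congr' fun x => contMDiffAt_section x

lemma localRep_hiddenSpinor (ψ : P.Spinor σ) {a : ι} {y : M} (hy : y ∈ P.baseSet a) :
    P.localRep a (P.hiddenSpinor ψ) y = σ.hidden (P.localRep a ψ y) :=
  (σ.hidden_diag (P.lift_mem a (P.indexAt y) y ⟨hy, P.mem_baseSet_at y⟩) (ψ y)).symm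

lemma localRep_hiddenSpinor_eventuallyEq (ψ : P.Spinor σ) (x : M) :
    P.localRep (P.indexAt x) (P.hiddenSpinor ψ) =ᶠ[nhds x]
      σ.hidden ∘ P.localRep (P.indexAt x) ψ := by
  filter_upwards [(P.isOpen_baseSet (P.indexAt x)).mem_nhds (P.mem_baseSet_at x)] with y hy
  exact P.localRep_hiddenSpinor ψ hy

lemma isCr_hiddenSpinor {r : ℕ∞} {ψ : P.Spinor σ} (hψ : P.IsCr r ψ) :
    P.IsCr r (P.hiddenSpinor ψ) :=
  (P.isCr_iff r _).2 fun x =>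
    (σ.contDiff_hidden.contMDiff.contMDiffAt.comp x ((P.isCr_iff r ψ).1 hψ x)).congr_of_eventuallyEq
      (P.localRep_hiddenSpinor_eventuallyEq ψ x)

lemma mfderiv_localRep_hiddenSpinor_apply {ψ : P.Spinor σ} {x : M}
    (hψ : MDifferentiableAt (𝓡 n) 𝓘(ℝ, Dbl S) (P.localRep (P.indexAt x) ψ) x)
    (v : TangentSpace (𝓡 n) x) :
    (mfderiv (𝓡 n) 𝓘(ℝ, Dbl S) (P.localRep (P.indexAt x) (P.hiddenSpinor ψ)) x v : Dbl S) =
      fderiv ℝ σ.hidden (ψ x : Dbl S)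
        (mfderiv (𝓡 n) 𝓘(ℝ, Dbl S) (P.localRep (P.indexAt x) ψ) x v : Dbl S) := by
  have hhidden : MDifferentiableAt 𝓘(ℝ, Dbl S) 𝓘(ℝ, Dbl S) σ.hidden
      (P.localRep (P.indexAt x) ψ x) :=
    (σ.contDiff_hidden.differentiable one_ne_zero _).mdifferentiableAt
  have hcomp := mfderiv_comp x hhidden hψ
  rw [mfderiv_eq_fderiv, P.localRep_indexAt] at hcomp
  rw [(P.localRep_hiddenSpinor_eventuallyEq ψ x).mfderiv_eq]
  exact DFunLike.congr_fun hcomp v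

lemma isKillingSpinor_hiddenSpinor
    {k : ∀ x : M, TangentSpace (𝓡 n) x →ₗ[ℝ] TangentSpace (𝓡 n) x →ₗ[ℝ] ℝ} {ψ : P.Spinor σ}
    (hψ : ∀ x, MDifferentiableAt (𝓡 n) 𝓘(ℝ, Dbl S) (P.localRep (P.indexAt x) ψ) x)
    (hK : P.IsKillingSpinor k ψ) : P.IsKillingSpinor k (P.hiddenSpinor ψ) := by
  rw [isKillingSpinor_iff] at hK ⊢
  intro x v
  rw [P.mfderiv_localRep_hiddenSpinor_apply (hψ x), hK x v]
  exact σ.fderiv_hidden_apply_of_mem (P.killingForm_mem_spinGenerators σ k x v) (ψ x)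

end SpinStructure

end SpinStructure

end

theorem theorem1p6_general {n : ℕ} {M : Type*} [TopologicalSpace M] [ChartedSpace (EucSp n) M]
    [IsManifold (𝓡 n) ∞ M] (g : RMetric n M)
    (k : ∀ x : M, TangentSpace (𝓡 n) x →ₗ[ℝ] TangentSpace (𝓡 n) x →ₗ[ℝ] ℝ)
    {S : Type*} [NormedAddCommGroup S] [InnerProductSpace ℂ S] [FiniteDimensional ℂ S]
    (σ : SpinorModule n S) {ι : Type*} (P : SpinStructure g ι)
    (r : ℕ∞) (hr : 1 ≤ r) (ψ : P.Spinor σ) (hψ : P.IsCr r ψ) (hK : P.IsKillingSpinor k ψ) :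
    P.IsCr r (P.hiddenSpinor ψ) ∧ P.IsKillingSpinor k (P.hiddenSpinor ψ) := by
  have hr0 : (r : WithTop ℕ∞) ≠ 0 := by exact_mod_cast (zero_lt_one.trans_le hr).ne'
  exact ⟨P.isCr_hiddenSpinor hψ, P.isKillingSpinor_hiddenSpinor
    (fun x => ((P.isCr_iff r ψ).1 hψ x).mdifferentiableAt hr0) hK⟩

theorem theorem1p6 {n : ℕ} {M : Type*} [TopologicalSpace M] [ChartedSpace (EucSp n) M]
    [IsManifold (𝓡 n) ∞ M] (g : RMetric n M)
    (k : ∀ x : M, TangentSpace (𝓡 n) x →ₗ[ℝ] TangentSpace (𝓡 n) x →ₗ[ℝ] ℝ)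
    (hk : ∀ (x : M) (v w : TangentSpace (𝓡 n) x), k x v w = k x w v)
    {S : Type*} [NormedAddCommGroup S] [InnerProductSpace ℂ S] [FiniteDimensional ℂ S]
    (σ : SpinorModule n S) {ι : Type*} (P : SpinStructure g ι)
    (r : ℕ∞) (hr : 1 ≤ r) (ψ : P.Spinor σ) (hψ : P.IsCr r ψ) (hK : P.IsKillingSpinor k ψ) :
    P.IsCr r (P.hiddenSpinor ψ) ∧ P.IsKillingSpinor k (P.hiddenSpinor ψ) :=
  theorem1p6_general g k σ P r hr ψ hψ hK
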